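/- Let $\mathcal G$ be a marked graph: a simple graph with countable vertex set $I$ and edge set $E$, together with subsets $I_1^{\mathrm{it}}\subseteq I_1\subseteq I$ (the odd isotropic and the odd vertices; the vertices in $I\setminus I_1$ are even). Fix a total order on $I$ and the associated lexicographical order on the free monoid $I^*$ of words in $I$. Give the free associative complex algebra on symbols $e_i$ $(i\in I)$ the $\mathbb Z/2$-grading in which $e_i$ is odd exactly when $i\in I_1$, and the bracket $[a,b]=ab-(-1)^{|a||b|}ba$ for homogeneous $a,b$. Let $\mathcal F$ be the Lie sub-superalgebra generated by the $e_i$ (the free Lie superalgebra), and let $\mathcal P(\mathcal G)=\mathcal F/\mathcal J$, where $\mathcal J$ is the ideal of $\mathcal F$ generated by $\{[e_i,e_j]: i\neq j,\ (i,j)\notin E\}\cup\{[e_i,e_i]: i\in I_1^{\mathrm{it}}\}$. Let $\mathbf U_{\mathcal G}$ be the universal enveloping algebra of $\mathcal P(\mathcal G)$, i.e. the tensor algebra of $\mathcal P(\mathcal G)$ modulo the two-sided ideal generated by the elements $[x,y]-x\otimes y+(-1)^{|x||y|}y\otimes x$ for homogeneous $x,y$. For a word $w=i_1i_2\cdots i_r$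 let $e_w=e_{i_1}e_{i_2}\cdots e_{i_r}\in\mathbf U_{\mathcal G}$. Let $\mathcal M(\mathcal G)=I^*/\!\sim$ be the Cartier–Foata monoid, where $\sim$ is the monoid congruence generated by $ab\sim ba$ for $(a,b)\notin E$, and write $[w]$ for the class of $w$ and $w_{\max}$ for the lexicographically largest word in $[w]$. For $i\in I$ let $a_i(w)$ be the largest $k\ge 0$ such that $[w]=[i^ku]$ for some $u\in I^*$, and put $$\mathcal M'(\mathcal G)=\{[w]\in\mathcal M(\mathcal G): \text{whenever } [w]=[w_1w_2],\ a_i(w_2)\le 1 \text{ for all } i\in I_1^{\mathrm{it}}\}.$$ Then the family $(e_{w_{\max}})_{[w]\in\mathcal M'(\mathcal G)}$ is a basis of the complex vector space $\mathbf U_{\mathcal G}$. -/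

import Mathlib

noncomputable section

/-! ## Lie superalgebras over the complex numbers -/

/-- The sign `(-1)^(ij)` for parities `i, j`. -/
def superSign (i j : ZMod 2) : ℂ := if i = 1 ∧ j = 1 then -1 else 1

@[simp] theorem superSign_zero_left (j : ZMod 2) : superSign 0 j = 1 := by simp [superSign]
@[simp] theorem superSign_zero_right (i : ZMod 2) : superSign i 0 = 1 := by simp [superSign]
@[simp] theorem superSign_one_one : superSign 1 1 = -1 := by simp [superSign]

theorem parity_cases : ∀ k : ZMod 2, k = 0 ∨ k = 1 := by decide

/-- A Lie superalgebra structure on a complex vector space `L`. -/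
structure LieSuperalgebra (L : Type*) [AddCommGroup L] [Module ℂ L] where
  /-- the even part `grade 0` and the odd part `grade 1` -/
  grade : ZMod 2 → Submodule ℂ L
  isCompl : IsCompl (grade 0) (grade 1)
  bracket : L →ₗ[ℂ] L →ₗ[ℂ] L
  bracket_mem : ∀ {i j : ZMod 2} {x y : L}, x ∈ grade i → y ∈ grade j →
    bracket x y ∈ grade (i + j)
  skew : ∀ {i j : ZMod 2} {x y : L}, x ∈ grade i → y ∈ grade j →
    bracket x y = -(superSign i j • bracket y x)
  jacobi : ∀ {i j k : ZMod 2} {x y z : L}, x ∈ grade i → y ∈ grade j → z ∈ grade k →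
    bracket x (bracket y z) = bracket (bracket x y) z + superSign i j • bracket y (bracket x z)

namespace LieSuperalgebra

/-! ### The Lie superalgebra of an associative superalgebra -/

section Associative

variable {A : Type*} [Ring A] [Algebra ℂ A] (𝒜 : ZMod 2 → Submodule ℂ A) [GradedAlgebra 𝒜]

/-- The bilinear extension of `[a, b] = a b - (-1)^(|a||b|) b a` from homogeneous elements. -/
def superCommutator : A →ₗ[ℂ] A →ₗ[ℂ] A :=
  ∑ i : ZMod 2, ∑ j : ZMod 2,
    (LinearMap.mul ℂ A - superSign i j • (LinearMap.mul ℂ A).flip).compl₁₂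
      (GradedAlgebra.proj 𝒜 i) (GradedAlgebra.proj 𝒜 j)

theorem superCommutator_of_mem {i j : ZMod 2} {a b : A} (ha : a ∈ 𝒜 i) (hb : b ∈ 𝒜 j) :
    superCommutator 𝒜 a b = a * b - superSign i j • (b * a) := by
  have pa : ∀ k, GradedAlgebra.proj 𝒜 k a = if i = k then a else 0 := by
    intro k
    split_ifs with h
    · subst h; rw [GradedAlgebra.proj_apply, DirectSum.decompose_of_mem_same _ ha]
    · rw [GradedAlgebra.proj_apply, DirectSum.decompose_of_mem_ne _ ha h]
  have pb : ∀ k, GradedAlgebra.proj 𝒜 k b = if j = k then b else 0 := by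
    intro k
    split_ifs with h
    · subst h; rw [GradedAlgebra.proj_apply, DirectSum.decompose_of_mem_same _ hb]
    · rw [GradedAlgebra.proj_apply, DirectSum.decompose_of_mem_ne _ hb h]
  simp only [superCommutator, LinearMap.sum_apply, LinearMap.compl₁₂_apply, LinearMap.sub_apply,
    LinearMap.smul_apply, LinearMap.flip_apply, LinearMap.mul_apply']
  rw [Finset.sum_eq_single i, Finset.sum_eq_single j]
  · simp [pa, pb]
  · intro k _ hk; simp [pb k, hk.symm]
  · simp
  · intro k _ hk; simp [pa k, hk.symm]
  · simp

theorem superCommutator_mem {i j : ZMod 2} {a b : A} (ha : a ∈ 𝒜 i) (hb : b ∈ 𝒜 j) :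
    superCommutator 𝒜 a b ∈ 𝒜 (i + j) := by
  rw [superCommutator_of_mem 𝒜 ha hb]
  refine sub_mem (SetLike.mul_mem_graded ha hb) (Submodule.smul_mem _ _ ?_)
  rw [add_comm]
  exact SetLike.mul_mem_graded hb ha

/-- An associative superalgebra as a Lie superalgebra. -/
def ofAssociative : LieSuperalgebra A where
  grade := 𝒜
  isCompl := (DirectSum.Decomposition.isInternal 𝒜).isCompl (by decide) (by
    ext k; simpa using parity_cases k)
  bracket := superCommutator 𝒜
  bracket_mem := superCommutator_mem 𝒜
  skew := by
    intro i j x y hx hy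
    rw [superCommutator_of_mem 𝒜 hx hy, superCommutator_of_mem 𝒜 hy hx]
    rcases parity_cases i with rfl | rfl <;> rcases parity_cases j with rfl | rfl <;>
      simp [add_comm]
  jacobi := by
    intro i j k x y z hx hy hz
    rw [superCommutator_of_mem 𝒜 hx (superCommutator_mem 𝒜 hy hz),
      superCommutator_of_mem 𝒜 (superCommutator_mem 𝒜 hx hy) hz,
      superCommutator_of_mem 𝒜 hy (superCommutator_mem 𝒜 hx hz),
      superCommutator_of_mem 𝒜 hx hy, superCommutator_of_mem 𝒜 hy hz,
      superCommutator_of_mem 𝒜 hx hz]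
    have h11 : (1 : ZMod 2) + 1 = 0 := by decide
    rcases parity_cases i with rfl | rfl <;> rcases parity_cases j with rfl | rfl <;>
      rcases parity_cases k with rfl | rfl <;> simp [h11] <;> noncomm_ring

end Associative

variable {L : Type*} [AddCommGroup L] [Module ℂ L] (𝔤 : LieSuperalgebra L)

/-! ### Sub-superalgebras and the sub-superalgebra generated by a set -/

/-- A Lie sub-superalgebra: a graded subspace closed under the bracket. -/
structure SubSuperalgebra where
  carrier : Submodule ℂ L
  graded : ∀ {a b : L}, a ∈ 𝔤.grade 0 → b ∈ 𝔤.grade 1 → a + b ∈ carrier →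
    a ∈ carrier ∧ b ∈ carrier
  bracket_mem : ∀ {x y : L}, x ∈ carrier → y ∈ carrier → 𝔤.bracket x y ∈ carrier

/-- The smallest Lie sub-superalgebra containing `S`. -/
def generated (S : Set L) : 𝔤.SubSuperalgebra where
  carrier := sInf {N | ∃ H : 𝔤.SubSuperalgebra, H.carrier = N ∧ S ⊆ N}
  graded := by
    intro a b ha hb hab
    simp only [Submodule.mem_sInf, Set.mem_ofPred_eq] at hab ⊢
    constructor
    · rintro _ ⟨H, rfl, hS⟩; exact (H.graded ha hb (hab _ ⟨H, rfl, hS⟩)).1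
    · rintro _ ⟨H, rfl, hS⟩; exact (H.graded ha hb (hab _ ⟨H, rfl, hS⟩)).2
  bracket_mem := by
    intro x y hx hy
    simp only [Submodule.mem_sInf, Set.mem_ofPred_eq] at hx hy ⊢
    rintro _ ⟨H, rfl, hS⟩
    exact H.bracket_mem (hx _ ⟨H, rfl, hS⟩) (hy _ ⟨H, rfl, hS⟩)

theorem subset_generated (S : Set L) : S ⊆ ((𝔤.generated S).carrier : Set L) := by
  intro x hx
  simp only [generated, SetLike.mem_coe, Submodule.mem_sInf, Set.mem_ofPred_eq]
  rintro _ ⟨H, rfl, hS⟩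
  exact hS hx

variable {𝔤}

/-- A Lie sub-superalgebra is a Lie superalgebra with the restricted grading and bracket. -/
def SubSuperalgebra.toLieSuperalgebra (H : 𝔤.SubSuperalgebra) : LieSuperalgebra H.carrier where
  grade i := (𝔤.grade i).comap H.carrier.subtype
  isCompl := by
    constructor
    · rw [Submodule.disjoint_def]
      intro x h0 h1
      exact Subtype.ext (Submodule.disjoint_def.mp 𝔤.isCompl.disjoint _ h0 h1)
    · rw [codisjoint_iff, eq_top_iff]
      rintro ⟨x, hx⟩ -
      obtain ⟨a, ha, b, hb, rfl⟩ := Submodule.mem_sup.mp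
        (show x ∈ 𝔤.grade 0 ⊔ 𝔤.grade 1 from by rw [𝔤.isCompl.sup_eq_top]; trivial)
      obtain ⟨ha', hb'⟩ := H.graded ha hb hx
      exact Submodule.mem_sup.mpr ⟨⟨a, ha'⟩, ha, ⟨b, hb'⟩, hb, rfl⟩
  bracket := LinearMap.mk₂ ℂ
    (fun x y => ⟨𝔤.bracket x y, H.bracket_mem x.2 y.2⟩)
    (by intros; ext; simp) (by intros; ext; simp) (by intros; ext; simp) (by intros; ext; simp)
  bracket_mem := fun hx hy => 𝔤.bracket_mem hx hy
  skew := fun hx hy => Subtype.ext (𝔤.skew hx hy)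
  jacobi := fun hx hy hz => Subtype.ext (𝔤.jacobi hx hy hz)

variable (𝔤)

/-! ### Ideals, the ideal generated by a set, and quotients -/

/-- An ideal of a Lie superalgebra: a graded subspace stable under bracketing with all elements. -/
structure SuperIdeal where
  carrier : Submodule ℂ L
  graded : ∀ {a b : L}, a ∈ 𝔤.grade 0 → b ∈ 𝔤.grade 1 → a + b ∈ carrier →
    a ∈ carrier ∧ b ∈ carrier
  bracket_mem_right : ∀ (x : L) {y : L}, y ∈ carrier → 𝔤.bracket x y ∈ carrier
  bracket_mem_left : ∀ {x : L} (y : L), x ∈ carrier → 𝔤.bracket x y ∈ carrier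

/-- The smallest ideal containing `S`. -/
def idealGenerated (S : Set L) : 𝔤.SuperIdeal where
  carrier := sInf {N | ∃ J : 𝔤.SuperIdeal, J.carrier = N ∧ S ⊆ N}
  graded := by
    intro a b ha hb hab
    simp only [Submodule.mem_sInf, Set.mem_ofPred_eq] at hab ⊢
    constructor
    · rintro _ ⟨H, rfl, hS⟩; exact (H.graded ha hb (hab _ ⟨H, rfl, hS⟩)).1
    · rintro _ ⟨H, rfl, hS⟩; exact (H.graded ha hb (hab _ ⟨H, rfl, hS⟩)).2
  bracket_mem_right := by
    intro x y hy
    simp only [Submodule.mem_sInf, Set.mem_ofPred_eq] at hy ⊢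
    rintro _ ⟨H, rfl, hS⟩
    exact H.bracket_mem_right _ (hy _ ⟨H, rfl, hS⟩)
  bracket_mem_left := by
    intro x y hx
    simp only [Submodule.mem_sInf, Set.mem_ofPred_eq] at hx ⊢
    rintro _ ⟨H, rfl, hS⟩
    exact H.bracket_mem_left _ (hx _ ⟨H, rfl, hS⟩)

variable {𝔤}

/-- The bracket on the quotient by an ideal, `[x + J, y + J] = [x, y] + J`. -/
def SuperIdeal.quotientBracket (J : 𝔤.SuperIdeal) :
    (L ⧸ J.carrier) →ₗ[ℂ] (L ⧸ J.carrier) →ₗ[ℂ] (L ⧸ J.carrier) :=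
  J.carrier.liftQ
    { toFun := fun x => J.carrier.mapQ J.carrier (𝔤.bracket x)
        (fun _ hy => J.bracket_mem_right x hy)
      map_add' := fun x y => by
        refine Submodule.linearMap_qext _ (LinearMap.ext fun z => ?_)
        simp [Submodule.mapQ_apply]
      map_smul' := fun c x => by
        refine Submodule.linearMap_qext _ (LinearMap.ext fun z => ?_)
        simp [Submodule.mapQ_apply] }
    (fun x hx => by
      rw [LinearMap.mem_ker]
      refine Submodule.linearMap_qext _ (LinearMap.ext fun z => ?_)
      simpa [Submodule.mapQ_apply] using J.bracket_mem_left z hx)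

@[simp] theorem SuperIdeal.quotientBracket_mk (J : 𝔤.SuperIdeal) (x y : L) :
    J.quotientBracket (J.carrier.mkQ x) (J.carrier.mkQ y) = J.carrier.mkQ (𝔤.bracket x y) := rfl

/-- The quotient of a Lie superalgebra by an ideal. -/
def SuperIdeal.quotient (J : 𝔤.SuperIdeal) : LieSuperalgebra (L ⧸ J.carrier) where
  grade i := (𝔤.grade i).map J.carrier.mkQ
  isCompl := by
    constructor
    · rw [Submodule.disjoint_def]
      rintro _ ⟨a, ha, rfl⟩ ⟨b, hb, hab⟩
      have h : a + -b ∈ J.carrier := by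
        have := (Submodule.Quotient.eq J.carrier).mp hab
        have h2 := neg_mem this
        rwa [neg_sub, sub_eq_add_neg] at h2
      simpa using (J.graded ha (neg_mem hb) h).1
    · rw [codisjoint_iff, ← Submodule.map_sup, 𝔤.isCompl.sup_eq_top, Submodule.map_top,
        Submodule.range_mkQ]
  bracket := J.quotientBracket
  bracket_mem := by
    rintro i j _ _ ⟨x, hx, rfl⟩ ⟨y, hy, rfl⟩
    exact ⟨_, 𝔤.bracket_mem hx hy, rfl⟩
  skew := by
    rintro i j _ _ ⟨x, hx, rfl⟩ ⟨y, hy, rfl⟩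
    rw [J.quotientBracket_mk, J.quotientBracket_mk, 𝔤.skew hx hy, map_neg, map_smul]
  jacobi := by
    rintro i j k _ _ _ ⟨x, hx, rfl⟩ ⟨y, hy, rfl⟩ ⟨z, hz, rfl⟩
    simp only [J.quotientBracket_mk]
    rw [𝔤.jacobi hx hy hz, map_add, map_smul]

variable (𝔤)

/-! ### The universal enveloping algebra -/

/-- The relations `[x, y] = x ⊗ y - (-1)^(|x||y|) y ⊗ x`, for homogeneous `x, y`, on the tensor
algebra. -/
inductive EnvelopingRel : TensorAlgebra ℂ L → TensorAlgebra ℂ L → Prop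
  | bracket {i j : ZMod 2} {x y : L} (hx : x ∈ 𝔤.grade i) (hy : y ∈ 𝔤.grade j) :
    EnvelopingRel (TensorAlgebra.ι ℂ (𝔤.bracket x y))
      (TensorAlgebra.ι ℂ x * TensorAlgebra.ι ℂ y
        - superSign i j • (TensorAlgebra.ι ℂ y * TensorAlgebra.ι ℂ x))

/-- The universal enveloping algebra: the tensor algebra modulo the two-sided ideal (as a ring
congruence) generated by the above relations. -/
def UniversalEnveloping : Type _ := (ringConGen 𝔤.EnvelopingRel).Quotient

instance : Ring 𝔤.UniversalEnveloping :=
  inferInstanceAs (Ring (ringConGen 𝔤.EnvelopingRel).Quotient)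

instance : Algebra ℂ 𝔤.UniversalEnveloping :=
  inferInstanceAs (Algebra ℂ (ringConGen 𝔤.EnvelopingRel).Quotient)

/-- The quotient map from the tensor algebra to the universal enveloping algebra. -/
def mkEnveloping : TensorAlgebra ℂ L →ₐ[ℂ] 𝔤.UniversalEnveloping :=
  RingCon.mkₐ ℂ (ringConGen 𝔤.EnvelopingRel)

/-- The canonical map from a Lie superalgebra to its universal enveloping algebra. -/
def toEnveloping : L →ₗ[ℂ] 𝔤.UniversalEnveloping :=
  𝔤.mkEnveloping.toLinearMap ∘ₗ TensorAlgebra.ι ℂ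

end LieSuperalgebra

/-! ## The free associative superalgebra and the free Lie superalgebra -/

section Free

variable {X : Type*} (p : X → ZMod 2)

/-- The parity of a word: it is odd exactly when it has an odd number of odd letters. -/
def wordParity (w : List X) : ZMod 2 := (w.map p).sum

/-- The grading of the free algebra on a `ℤ/2`-graded set (with parity function `p`): the part of
degree `k` is spanned by the words of parity `k`. -/
def freeGrading (k : ZMod 2) : Submodule ℂ (FreeAlgebra ℂ X) :=
  Submodule.span ℂ {a | ∃ w : List X, wordParity p w = k ∧ (w.map (FreeAlgebra.ι ℂ)).prod = a}

theorem word_mem_freeGrading (w : List X) :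
    (w.map (FreeAlgebra.ι ℂ)).prod ∈ freeGrading p (wordParity p w) :=
  Submodule.subset_span ⟨w, rfl, rfl⟩

theorem ι_mem_freeGrading (x : X) : FreeAlgebra.ι ℂ x ∈ freeGrading p (p x) := by
  simpa [wordParity] using word_mem_freeGrading p [x]

instance freeGradedMonoid : SetLike.GradedMonoid (freeGrading p) where
  one_mem := by simpa [wordParity] using word_mem_freeGrading p []
  mul_mem := by
    intro i j a b ha hb
    have h : freeGrading p i * freeGrading p j ≤ freeGrading p (i + j) := by
      rw [freeGrading, freeGrading, Submodule.span_mul_span, Submodule.span_le]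
      rintro _ ⟨_, ⟨v, rfl, rfl⟩, _, ⟨w, rfl, rfl⟩, rfl⟩
      simpa [wordParity] using word_mem_freeGrading p (v ++ w)
    exact h (Submodule.mul_mem_mul ha hb)

/-- The free associative superalgebra. -/
instance freeGradedAlgebra : GradedAlgebra (freeGrading p) :=
  GradedAlgebra.ofAlgHom _
    (FreeAlgebra.lift ℂ fun x =>
      DirectSum.of (fun k => freeGrading p k) (p x) ⟨FreeAlgebra.ι ℂ x, ι_mem_freeGrading p x⟩)
    (by ext x; simp)
    (by
      have key : ∀ w : List X, (FreeAlgebra.lift ℂ fun x =>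
          DirectSum.of (fun k => freeGrading p k) (p x)
            ⟨FreeAlgebra.ι ℂ x, ι_mem_freeGrading p x⟩) (w.map (FreeAlgebra.ι ℂ)).prod =
          DirectSum.of (fun k => freeGrading p k) (wordParity p w)
            ⟨(w.map (FreeAlgebra.ι ℂ)).prod, word_mem_freeGrading p w⟩ := by
        intro w
        induction w with
        | nil => simp; rfl
        | cons x w ih =>
          refine (map_mul _ (FreeAlgebra.ι ℂ x) (w.map (FreeAlgebra.ι ℂ)).prod).trans ?_
          rw [ih, FreeAlgebra.lift_ι_apply, DirectSum.of_mul_of]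
          exact DirectSum.of_eq_of_gradedMonoid_eq (Sigma.subtype_ext rfl rfl)
      rintro i ⟨a, ha⟩
      induction ha using Submodule.span_induction with
      | mem a h => obtain ⟨w, rfl, rfl⟩ := h; exact key w
      | zero => rw [map_zero]; exact (map_zero (DirectSum.of (fun k => freeGrading p k) i)).symm
      | add a b ha hb iha ihb =>
        change _ at iha ihb
        rw [map_add, iha, ihb, ← map_add]; rfl
      | smul c a ha iha =>
        rw [map_smul, iha, ← DirectSum.lof_eq_of ℂ, ← map_smul]; rfl)

/-- The free associative superalgebra on a graded set, as a Lie superalgebra. -/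
def freeAssociative : LieSuperalgebra (FreeAlgebra ℂ X) :=
  LieSuperalgebra.ofAssociative (freeGrading p)

/-- The Lie sub-superalgebra generated by the letters inside the free associative superalgebra. -/
def freeLieSub : (freeAssociative p).SubSuperalgebra :=
  (freeAssociative p).generated (Set.range (FreeAlgebra.ι ℂ))

/-- The free Lie superalgebra on a graded set. -/
def freeLie : LieSuperalgebra (freeLieSub p).carrier := (freeLieSub p).toLieSuperalgebra

/-- The generators of the free Lie superalgebra. -/
def freeLieGen (x : X) : (freeLieSub p).carrier :=
  ⟨FreeAlgebra.ι ℂ x, (freeAssociative p).subset_generated _ ⟨x, rfl⟩⟩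

end Free

/-! ## Marked graphs and partially commutative Lie superalgebras -/

/-- A marked graph: a simple graph with a set `I₁` of odd vertices and a subset of `I₁` of odd
isotropic vertices. -/
structure MarkedGraph (I : Type*) where
  graph : SimpleGraph I
  odd : Set I
  isotropic : Set I
  isotropic_subset : isotropic ⊆ odd

namespace MarkedGraph

variable {I : Type*} (G : MarkedGraph I)

open Classical in
/-- The parity of a vertex. -/
def parity (i : I) : ZMod 2 := if i ∈ G.odd then 1 else 0

/-- The defining relators `[e_i, e_j]` for distinct non-adjacent `i, j`, and `[e_i, e_i]` for `i`
odd isotropic. -/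
def relators : Set (freeLieSub G.parity).carrier :=
  {z | ∃ i j, i ≠ j ∧ ¬ G.graph.Adj i j ∧
    z = (freeLie G.parity).bracket (freeLieGen G.parity i) (freeLieGen G.parity j)} ∪
  {z | ∃ i ∈ G.isotropic,
    z = (freeLie G.parity).bracket (freeLieGen G.parity i) (freeLieGen G.parity i)}

/-- The ideal generated by the defining relators. -/
def relatorIdeal : (freeLie G.parity).SuperIdeal := (freeLie G.parity).idealGenerated G.relators

/-- The partially commutative Lie superalgebra `P(G)`, the quotient of the free Lie superalgebra on
the vertices by the ideal generated by the relators. -/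
def pcLie : LieSuperalgebra ((freeLieSub G.parity).carrier ⧸ G.relatorIdeal.carrier) :=
  G.relatorIdeal.quotient

/-- The universal enveloping algebra of `P(G)`. -/
abbrev U : Type _ := G.pcLie.UniversalEnveloping

/-- The generator `e_i` of the universal enveloping algebra of `P(G)`. -/
def e (i : I) : G.U :=
  G.pcLie.toEnveloping (G.relatorIdeal.carrier.mkQ (freeLieGen G.parity i))

/-- The monomial `e_w = e_{i_1} ⋯ e_{i_r}` of a word `w = i_1 ⋯ i_r`. -/
def monomial (w : List I) : G.U := (w.map G.e).prod

/-! ### The Cartier-Foata monoid -/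

/-- The elementary commutations `ab ∼ ba` for non-adjacent `a, b`. -/
inductive CommRel : FreeMonoid I → FreeMonoid I → Prop
  | swap {a b : I} (h : ¬ G.graph.Adj a b) :
    CommRel (FreeMonoid.of a * FreeMonoid.of b) (FreeMonoid.of b * FreeMonoid.of a)

/-- The Cartier-Foata monoid `M(G)`. -/
abbrev CartierFoata : Type _ := (conGen G.CommRel).Quotient

/-- The class `[w]` of a word `w` in the Cartier-Foata monoid. -/
def cls (w : List I) : G.CartierFoata := (conGen G.CommRel).mk' (FreeMonoid.ofList w)

/-- The multiset of letters of an element of the Cartier-Foata monoid. -/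
def letters : G.CartierFoata →* Multiplicative (Multiset I) :=
  (conGen G.CommRel).lift (FreeMonoid.lift fun i => Multiplicative.ofAdd {i}) (by
    rw [Con.conGen_le]
    rintro _ _ ⟨h⟩
    simp [Con.ker_rel, mul_comm])

theorem letters_cls (w : List I) : G.letters (G.cls w) = Multiplicative.ofAdd (w : Multiset I) := by
  induction w with
  | nil => exact map_one _
  | cons a w ih =>
    have h : G.cls (a :: w) = G.cls [a] * G.cls w := rfl
    have h1 : G.letters (G.cls [a]) = Multiplicative.ofAdd {a} := rfl
    rw [h, map_mul, ih, h1, ← ofAdd_add, Multiset.singleton_add, Multiset.cons_coe]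

/-- The initial multiplicity of `i` in `m`: the largest `k` such that `m = [i^k u]` for some word
`u`. -/
def initialMultiplicity (i : I) (m : G.CartierFoata) : ℕ :=
  sSup {k | ∃ u : List I, m = G.cls (List.replicate k i ++ u)}

theorem initialMultiplicity_isGreatest (i : I) (m : G.CartierFoata) :
    IsGreatest {k | ∃ u : List I, m = G.cls (List.replicate k i ++ u)}
      (G.initialMultiplicity i m) := by
  have hne : {k | ∃ u : List I, m = G.cls (List.replicate k i ++ u)}.Nonempty := by
    obtain ⟨w, rfl⟩ := (conGen G.CommRel).mk'_surjective m
    exact ⟨0, FreeMonoid.toList w, rfl⟩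
  have hbd : BddAbove {k | ∃ u : List I, m = G.cls (List.replicate k i ++ u)} := by
    refine ⟨(Multiplicative.toAdd (G.letters m)).card, ?_⟩
    rintro k ⟨u, rfl⟩
    simp [letters_cls]
  exact ⟨Nat.sSup_mem hne hbd, fun k hk => le_csSup hbd hk⟩

/-- The set `M'(G)`: the elements such that every right factor has initial multiplicity at most one
at every odd isotropic vertex. -/
def modifiedMonoid : Set G.CartierFoata :=
  {m | ∀ w₁ w₂ : List I, m = G.cls (w₁ ++ w₂) →
    ∀ i ∈ G.isotropic, G.initialMultiplicity i (G.cls w₂) ≤ 1}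

variable [LinearOrder I]

/-- Every class of words has a greatest element for the lexicographical order. -/
theorem exists_isGreatest_cls (m : G.CartierFoata) :
    ∃ w : List I, IsGreatest {v : List I | G.cls v = m} w := by
  obtain ⟨w, hw⟩ := (conGen G.CommRel).mk'_surjective m
  have hfin : {v : List I | G.cls v = m}.Finite := by
    refine (List.finite_toSet (FreeMonoid.toList w).permutations).subset ?_
    intro v hv
    have h : G.letters (G.cls v) = G.letters (G.cls (FreeMonoid.toList w)) :=
      congrArg G.letters (Eq.trans hv hw.symm)
    rw [letters_cls, letters_cls] at h
    simpa using Multiset.coe_eq_coe.mp (Multiplicative.ofAdd.injective h)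
  obtain ⟨v, hv, hmax⟩ := Set.exists_max_image _ id hfin ⟨FreeMonoid.toList w, hw⟩
  exact ⟨v, hv, fun u hu => hmax u hu⟩

/-- The lexicographically greatest word `w_max` in the class `m`. -/
def wMax (m : G.CartierFoata) : List I := (G.exists_isGreatest_cls m).choose

theorem wMax_isGreatest (m : G.CartierFoata) :
    IsGreatest {v : List I | G.cls v = m} (G.wMax m) := (G.exists_isGreatest_cls m).choose_spec

end MarkedGraph

end

/-! The enveloping algebra turns out to be presented by the generators $e_i$ with the relations
$e_ie_j=\pm e_je_i$ for distinct non-adjacent $i,j$ and $e_i^2=0$ for isotropic $i$; no theorem of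
Poincaré–Birkhoff–Witt type is needed.

Spanning. The $e_i$ generate $\mathbf U_{\mathcal G}$ (`adjoin_range_e`), so the monomials $e_w$
span it. Words of one class have proportional monomials (`exists_monomial_eq_smul`), and $e_w=0$
when $[w]\notin\mathcal M'(\mathcal G)$, because $w$ can then be rearranged so that an isotropic
letter is repeated consecutively (`monomial_eq_zero`). One word per class in $\mathcal M'(\mathcal
G)$ is enough; of $w_{\max}$ only the fact that it represents its class enters.

Independence. By the universal property `lift`, operators satisfying the relations define a
representation. Let $e_i$ act on the vector space with basis $\mathcal M(\mathcal G)$ by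
$m\mapsto\pm[i]m$ if $[i]m\in\mathcal M'(\mathcal G)$ and $m\mapsto 0$ otherwise. The sign is what
sorting $i$ past the smaller letters of $m$ would cost; it depends only on the letters of $m$, hence
is well defined on classes, and interchanging $i$ and $j$ changes the total sign by exactly
$(-1)^{|i||j|}$ (`leftOp_mul_comm`). Applied to the basis vector of the empty word, $e_w$ with
$[w]\in\mathcal M'(\mathcal G)$ gives a nonzero multiple of the basis vector $[w]$
(`exists_rep_monomial`), and distinct classes give independent vectors. -/

noncomputable section

namespace LieSuperalgebra

variable {L : Type*} [AddCommGroup L] [Module ℂ L] (𝔤 : LieSuperalgebra L)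

/-! ### Homogeneous criteria for generated sub-superalgebras and ideals -/

/-- The largest graded subspace of `N`. -/
def gradedPart (N : Submodule ℂ L) : Submodule ℂ L := (N ⊓ 𝔤.grade 0) ⊔ (N ⊓ 𝔤.grade 1)

theorem gradedPart_le (N : Submodule ℂ L) : 𝔤.gradedPart N ≤ N := sup_le inf_le_left inf_le_left

theorem mem_gradedPart {N : Submodule ℂ L} {i : ZMod 2} {x : L} (hx : x ∈ N)
    (hi : x ∈ 𝔤.grade i) : x ∈ 𝔤.gradedPart N := by
  rcases parity_cases i with rfl | rfl
  · exact Submodule.mem_sup_left ⟨hx, hi⟩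
  · exact Submodule.mem_sup_right ⟨hx, hi⟩

theorem gradedPart_graded {N : Submodule ℂ L} {a b : L} (ha : a ∈ 𝔤.grade 0) (hb : b ∈ 𝔤.grade 1)
    (hab : a + b ∈ 𝔤.gradedPart N) : a ∈ 𝔤.gradedPart N ∧ b ∈ 𝔤.gradedPart N := by
  obtain ⟨a', ha', b', hb', h⟩ := Submodule.mem_sup.mp hab
  -- This element is both even and odd, hence zero.
  have hd : a' - a = b - b' := by rw [sub_eq_sub_iff_add_eq_add, h, add_comm]
  have h0 : a' - a = 0 := Submodule.disjoint_def.mp 𝔤.isCompl.disjoint _ (sub_mem ha'.2 ha)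
    (hd ▸ sub_mem hb hb'.2)
  have h1 : b - b' = 0 := hd ▸ h0
  rw [← sub_eq_zero.mp h0, sub_eq_zero.mp h1]
  exact ⟨𝔤.mem_gradedPart ha'.1 ha'.2, 𝔤.mem_gradedPart hb'.1 hb'.2⟩

theorem exists_homogeneous_add (x : L) : ∃ a ∈ 𝔤.grade 0, ∃ b ∈ 𝔤.grade 1, a + b = x :=
  Submodule.mem_sup.mp (𝔤.isCompl.sup_eq_top ▸ Submodule.mem_top)

/-- `N` need not be graded: its largest graded subspace already contains `S` and is a
sub-superalgebra. Hence closure has to be tested on homogeneous elements only, where the bracket has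
an explicit formula. -/
theorem generated_le {S : Set L} {N : Submodule ℂ L} (hS : S ⊆ N)
    (hhom : ∀ s ∈ S, ∃ i, s ∈ 𝔤.grade i)
    (hN : ∀ {i j : ZMod 2} {x y : L}, x ∈ N → x ∈ 𝔤.grade i → y ∈ N → y ∈ 𝔤.grade j →
      𝔤.bracket x y ∈ N) : (𝔤.generated S).carrier ≤ N := by
  let H : 𝔤.SubSuperalgebra :=
    { carrier := 𝔤.gradedPart N
      graded := 𝔤.gradedPart_graded
      bracket_mem := by
        have key : ∀ {i j : ZMod 2} {x y : L}, x ∈ N ⊓ 𝔤.grade i → y ∈ N ⊓ 𝔤.grade j →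
            𝔤.bracket x y ∈ 𝔤.gradedPart N := fun hx hy =>
          𝔤.mem_gradedPart (hN hx.1 hx.2 hy.1 hy.2) (𝔤.bracket_mem hx.2 hy.2)
        intro x y hx hy
        obtain ⟨a, ha, b, hb, rfl⟩ := Submodule.mem_sup.mp hx
        obtain ⟨c, hc, d, hd, rfl⟩ := Submodule.mem_sup.mp hy
        simp only [map_add, LinearMap.add_apply]
        exact add_mem (add_mem (key ha hc) (key hb hc)) (add_mem (key ha hd) (key hb hd)) }
  refine le_trans (b := H.carrier) (sInf_le ⟨H, rfl, fun s hs => ?_⟩) (𝔤.gradedPart_le N)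
  exact 𝔤.mem_gradedPart (hS hs) (hhom s hs).choose_spec

/-- As for `generated_le`; skew-symmetry turns stability under brackets from one side into stability
from both. -/
theorem idealGenerated_le {S : Set L} {N : Submodule ℂ L} (hS : S ⊆ N)
    (hhom : ∀ s ∈ S, ∃ i, s ∈ 𝔤.grade i)
    (hN : ∀ {i j : ZMod 2} {x y : L}, x ∈ 𝔤.grade i → y ∈ N → y ∈ 𝔤.grade j →
      𝔤.bracket x y ∈ N) : (𝔤.idealGenerated S).carrier ≤ N := by
  have key : ∀ {i j : ZMod 2} {x y : L}, x ∈ 𝔤.grade i → y ∈ N ⊓ 𝔤.grade j →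
      𝔤.bracket x y ∈ 𝔤.gradedPart N := fun hx hy =>
    𝔤.mem_gradedPart (hN hx hy.1 hy.2) (𝔤.bracket_mem hx hy.2)
  have key' : ∀ {i j : ZMod 2} {x y : L}, x ∈ N ⊓ 𝔤.grade i → y ∈ 𝔤.grade j →
      𝔤.bracket x y ∈ 𝔤.gradedPart N := fun hx hy => by
    rw [𝔤.skew hx.2 hy]
    exact neg_mem (Submodule.smul_mem _ _ (key hy hx))
  let J : 𝔤.SuperIdeal :=
    { carrier := 𝔤.gradedPart N
      graded := 𝔤.gradedPart_graded
      bracket_mem_right := by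
        intro x y hy
        obtain ⟨a, ha, b, hb, rfl⟩ := 𝔤.exists_homogeneous_add x
        obtain ⟨c, hc, d, hd, rfl⟩ := Submodule.mem_sup.mp hy
        simp only [map_add, LinearMap.add_apply]
        exact add_mem (add_mem (key ha hc) (key hb hc)) (add_mem (key ha hd) (key hb hd))
      bracket_mem_left := by
        intro x y hx
        obtain ⟨a, ha, b, hb, rfl⟩ := Submodule.mem_sup.mp hx
        obtain ⟨c, hc, d, hd, rfl⟩ := 𝔤.exists_homogeneous_add y
        simp only [map_add, LinearMap.add_apply]
        exact add_mem (add_mem (key' ha hc) (key' hb hc)) (add_mem (key' ha hd) (key' hb hd)) }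
  refine le_trans (b := J.carrier) (sInf_le ⟨J, rfl, fun s hs => ?_⟩) (𝔤.gradedPart_le N)
  exact 𝔤.mem_gradedPart (hS hs) (hhom s hs).choose_spec

theorem subset_idealGenerated (S : Set L) : S ⊆ ((𝔤.idealGenerated S).carrier : Set L) := by
  intro x hx
  simp only [idealGenerated, SetLike.mem_coe, Submodule.mem_sInf, Set.mem_ofPred_eq]
  rintro _ ⟨J, rfl, hS⟩
  exact hS hx

/-! ### Universal property of the enveloping algebra -/

theorem toEnveloping_bracket {i j : ZMod 2} {x y : L} (hx : x ∈ 𝔤.grade i) (hy : y ∈ 𝔤.grade j) :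
    𝔤.toEnveloping (𝔤.bracket x y) = 𝔤.toEnveloping x * 𝔤.toEnveloping y
      - superSign i j • (𝔤.toEnveloping y * 𝔤.toEnveloping x) := by
  have h : 𝔤.mkEnveloping (TensorAlgebra.ι ℂ (𝔤.bracket x y)) =
      𝔤.mkEnveloping (TensorAlgebra.ι ℂ x * TensorAlgebra.ι ℂ y
        - superSign i j • (TensorAlgebra.ι ℂ y * TensorAlgebra.ι ℂ x)) :=
    (RingCon.eq _).mpr (RingConGen.Rel.of _ _ (.bracket hx hy))
  rw [map_sub, map_smul, map_mul, map_mul] at h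
  exact h

theorem adjoin_range_toEnveloping : Algebra.adjoin ℂ (Set.range 𝔤.toEnveloping) = ⊤ := by
  have h : Set.range 𝔤.toEnveloping = 𝔤.mkEnveloping '' Set.range (TensorAlgebra.ι ℂ) := by
    rw [← Set.range_comp]; rfl
  rw [h, ← AlgHom.map_adjoin, TensorAlgebra.adjoin_range_ι, Algebra.map_top]
  exact AlgHom.range_eq_top _ |>.mpr (RingCon.mkₐ_surjective _)

variable {A : Type*} [Ring A] [Algebra ℂ A]

/-- The algebra map out of the enveloping algebra induced by a linear map that sends brackets to
supercommutators. -/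
def liftEnveloping (f : L →ₗ[ℂ] A)
    (hf : ∀ (i j : ZMod 2) (x y : L), x ∈ 𝔤.grade i → y ∈ 𝔤.grade j →
      f (𝔤.bracket x y) = f x * f y - superSign i j • (f y * f x)) :
    𝔤.UniversalEnveloping →ₐ[ℂ] A :=
  RingCon.liftₐ _ (TensorAlgebra.lift ℂ f) (by
    rw [RingCon.ringConGen_le]
    rintro _ _ ⟨hx, hy⟩
    simpa [RingCon.ker_apply] using hf _ _ _ _ hx hy)

theorem liftEnveloping_toEnveloping (f : L →ₗ[ℂ] A) (hf) (x : L) :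
    𝔤.liftEnveloping f hf (𝔤.toEnveloping x) = f x :=
  TensorAlgebra.lift_ι_apply f x

end LieSuperalgebra

namespace MarkedGraph

variable {I : Type*} (G : MarkedGraph I)

/-! ### Relations and spanning monomials of the enveloping algebra -/

theorem freeLieGen_mem (i : I) :
    freeLieGen G.parity i ∈ (freeLie G.parity).grade (G.parity i) :=
  ι_mem_freeGrading G.parity i

theorem parity_isotropic {i : I} (hi : i ∈ G.isotropic) : G.parity i = 1 :=
  if_pos (G.isotropic_subset hi)

theorem e_bracket {i j : I}
    (h : (freeLie G.parity).bracket (freeLieGen G.parity i) (freeLieGen G.parity j)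
      ∈ G.relators) :
    G.e i * G.e j - superSign (G.parity i) (G.parity j) • (G.e j * G.e i) = 0 := by
  have hb := G.pcLie.toEnveloping_bracket
    (Submodule.mem_map_of_mem (f := G.relatorIdeal.carrier.mkQ) (G.freeLieGen_mem i))
    (Submodule.mem_map_of_mem (f := G.relatorIdeal.carrier.mkQ) (G.freeLieGen_mem j))
  refine hb.symm.trans ?_
  have h0 : G.relatorIdeal.carrier.mkQ
      ((freeLie G.parity).bracket (freeLieGen G.parity i) (freeLieGen G.parity j)) = 0 :=
    (Submodule.Quotient.mk_eq_zero _).mpr (LieSuperalgebra.subset_idealGenerated _ _ h)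
  exact (congrArg G.pcLie.toEnveloping h0).trans (map_zero _)

theorem e_mul_comm {i j : I} (hij : i ≠ j) (h : ¬ G.graph.Adj i j) :
    G.e i * G.e j = superSign (G.parity i) (G.parity j) • (G.e j * G.e i) :=
  sub_eq_zero.mp (G.e_bracket (Or.inl ⟨i, j, hij, h, rfl⟩))

theorem e_mul_self {i : I} (hi : i ∈ G.isotropic) : G.e i * G.e i = 0 := by
  have h := G.e_bracket (i := i) (j := i) (Or.inr ⟨i, hi, rfl⟩)
  -- For odd `i` the relator reads $2e_i^2=0$, and 2 is invertible.
  rw [G.parity_isotropic hi, superSign_one_one, neg_one_smul, sub_neg_eq_add, ← two_smul ℂ] at h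
  exact (smul_eq_zero.mp h).resolve_left two_ne_zero

/-- The elements of the free Lie superalgebra whose image lies in the subalgebra generated by the `e
i` are closed under homogeneous brackets, since these become supercommutators in `G.U`; as they
include the generators, they are everything. -/
theorem adjoin_range_e : Algebra.adjoin ℂ (Set.range G.e) = ⊤ := by
  rw [eq_top_iff, ← LieSuperalgebra.adjoin_range_toEnveloping, Algebra.adjoin_le_iff]
  rintro _ ⟨x, rfl⟩
  obtain ⟨⟨y, hy⟩, rfl⟩ := G.relatorIdeal.carrier.mkQ_surjective x
  let f := G.pcLie.toEnveloping ∘ₗ G.relatorIdeal.carrier.mkQ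
  -- The preimage is pushed forward to the free associative algebra, where the generated
  -- sub-superalgebra lives.
  let N : Submodule ℂ (FreeAlgebra ℂ I) :=
    ((Algebra.adjoin ℂ (Set.range G.e)).toSubmodule.comap f).map (freeLieSub G.parity).carrier.subtype
  have hN : (freeLieSub G.parity).carrier ≤ N := by
    refine LieSuperalgebra.generated_le _ ?_ ?_ ?_
    · rintro _ ⟨i, rfl⟩
      exact ⟨freeLieGen G.parity i, Algebra.subset_adjoin ⟨i, rfl⟩, rfl⟩
    · rintro _ ⟨i, rfl⟩
      exact ⟨_, ι_mem_freeGrading G.parity i⟩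
    · rintro i j _ _ ⟨x, hx, rfl⟩ hxi ⟨y, hy, rfl⟩ hyj
      refine ⟨(freeLie G.parity).bracket x y, ?_, rfl⟩
      have hb : f ((freeLie G.parity).bracket x y) =
          f x * f y - superSign i j • (f y * f x) :=
        G.pcLie.toEnveloping_bracket
          (Submodule.mem_map_of_mem (f := G.relatorIdeal.carrier.mkQ)
            (show x ∈ (freeLie G.parity).grade i from hxi))
          (Submodule.mem_map_of_mem (f := G.relatorIdeal.carrier.mkQ)
            (show y ∈ (freeLie G.parity).grade j from hyj))
      change f _ ∈ Algebra.adjoin ℂ (Set.range G.e)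
      rw [hb]
      exact sub_mem (mul_mem hx hy) (Subalgebra.smul_mem _ (mul_mem hy hx) _)
  obtain ⟨z, hz, hzy⟩ := hN hy
  obtain rfl : z = ⟨y, hy⟩ := Subtype.ext hzy
  exact hz

theorem span_range_monomial : Submodule.span ℂ (Set.range G.monomial) = ⊤ := by
  rw [eq_top_iff, ← Algebra.top_toSubmodule, ← G.adjoin_range_e, Algebra.adjoin_eq_span]
  refine Submodule.span_mono fun x hx => ?_
  obtain ⟨l, hl, rfl⟩ := Submonoid.exists_list_of_mem_closure hx
  obtain ⟨w, rfl⟩ : l ∈ Set.range (List.map G.e) := by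
    rw [Set.range_list_map]; exact hl
  exact ⟨w, rfl⟩

theorem monomial_append (v w : List I) :
    G.monomial (v ++ w) = G.monomial v * G.monomial w := by
  simp [monomial]

/-- Proportionality of monomials by a unit is a monoid congruence, so it suffices to check the
generating commutations. -/
theorem exists_monomial_eq_smul {v w : List I} (h : G.cls v = G.cls w) :
    ∃ c : ℂˣ, G.monomial v = c • G.monomial w := by
  let r : Con (FreeMonoid I) :=
    { r := fun v w => ∃ c : ℂˣ, G.monomial v.toList = c • G.monomial w.toList
      iseqv :=
        ⟨fun v => ⟨1, (one_smul _ _).symm⟩,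
          fun ⟨c, hc⟩ => ⟨c⁻¹, by rw [hc, inv_smul_smul]⟩,
          fun ⟨c, hc⟩ ⟨d, hd⟩ => ⟨c * d, by rw [hc, hd, mul_smul]⟩⟩
      mul' := by
        rintro v v' w w' ⟨c, hc⟩ ⟨d, hd⟩
        refine ⟨c * d, ?_⟩
        rw [FreeMonoid.toList_mul, FreeMonoid.toList_mul, monomial_append, monomial_append, hc, hd,
          smul_mul_smul_comm] }
  have hr : conGen G.CommRel ≤ r := by
    rw [Con.conGen_le]
    rintro _ _ ⟨h⟩
    rename_i a b
    by_cases hab : a = b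
    -- `CommRel` includes the trivial swap of a letter with itself, for which there is no sign to
    -- account for.
    · subst hab; exact r.refl _
    · have hne : superSign (G.parity a) (G.parity b) ≠ 0 := by
        unfold superSign; split_ifs <;> simp
      refine ⟨Units.mk0 _ hne, ?_⟩
      simpa [monomial, Units.smul_def] using G.e_mul_comm hab h
  exact hr ((Con.eq _).mp h)

/-! ### The modified monoid -/

theorem cls_append (v w : List I) : G.cls (v ++ w) = G.cls v * G.cls w := rfl

theorem cls_surjective : Function.Surjective G.cls := (conGen G.CommRel).mk'_surjective

theorem mem_modifiedMonoid_of_mul {m n : G.CartierFoata} (h : m * n ∈ G.modifiedMonoid) :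
    n ∈ G.modifiedMonoid := by
  obtain ⟨v, rfl⟩ := G.cls_surjective m
  rintro w₁ w₂ rfl
  exact h (v ++ w₁) w₂ (by rw [List.append_assoc, G.cls_append v])

theorem sq_mul_notMem_modifiedMonoid {i : I} (hi : i ∈ G.isotropic) (m : G.CartierFoata) :
    G.cls [i] * (G.cls [i] * m) ∉ G.modifiedMonoid := by
  obtain ⟨w, rfl⟩ := G.cls_surjective m
  intro h
  have h1 := h [] ([i, i] ++ w) rfl i hi
  have h2 : 2 ≤ G.initialMultiplicity i (G.cls ([i, i] ++ w)) :=
    (G.initialMultiplicity_isGreatest i _).2 ⟨w, rfl⟩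
  omega

theorem monomial_eq_zero {w : List I} (hw : G.cls w ∉ G.modifiedMonoid) : G.monomial w = 0 := by
  simp only [modifiedMonoid, Set.mem_ofPred_eq, not_forall, not_le] at hw
  obtain ⟨w₁, w₂, h, i, hi, hk⟩ := hw
  obtain ⟨u, hu⟩ := (G.initialMultiplicity_isGreatest i (G.cls w₂)).1
  -- The multiplicity is at least 2, so it is written as `k + 2` to expose the factor $e_i^2$.
  obtain ⟨k, hk'⟩ := Nat.exists_eq_add_of_le' hk
  obtain ⟨c, hc⟩ := G.exists_monomial_eq_smul h
  obtain ⟨d, hd⟩ := G.exists_monomial_eq_smul hu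
  have h0 : G.monomial (List.replicate (k + 2) i ++ u) = 0 := by
    simp [monomial, List.replicate_succ, ← mul_assoc, G.e_mul_self hi]
  rw [hk'] at hd
  rw [hc, monomial_append, hd, h0, smul_zero, mul_zero, smul_zero]

/-! ### Universal property -/

section Lift

variable {A : Type*} [Ring A] [Algebra ℂ A] (f : I → A)

/-- The restriction to the free Lie superalgebra of the algebra map extending `f`. -/
def freeLieMap : (freeLieSub G.parity).carrier →ₗ[ℂ] A :=
  (FreeAlgebra.lift ℂ f).toLinearMap ∘ₗ (freeLieSub G.parity).carrier.subtype

theorem freeLieMap_gen (i : I) : G.freeLieMap f (freeLieGen G.parity i) = f i :=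
  FreeAlgebra.lift_ι_apply _ _

/-- The signs come from the parities in the source, so the target `A` needs no grading. -/
theorem freeLieMap_bracket {i j : ZMod 2} {x y : (freeLieSub G.parity).carrier}
    (hx : x ∈ (freeLie G.parity).grade i) (hy : y ∈ (freeLie G.parity).grade j) :
    G.freeLieMap f ((freeLie G.parity).bracket x y) =
      G.freeLieMap f x * G.freeLieMap f y
        - superSign i j • (G.freeLieMap f y * G.freeLieMap f x) := by
  have h := LieSuperalgebra.superCommutator_of_mem (freeGrading G.parity) hx hy
  refine (congrArg (FreeAlgebra.lift ℂ f) h).trans ?_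
  rw [map_sub, map_smul, map_mul, map_mul]
  rfl

variable {f}

theorem relatorIdeal_le_ker_freeLieMap
    (hcomm : ∀ i j, i ≠ j → ¬ G.graph.Adj i j →
      f i * f j = superSign (G.parity i) (G.parity j) • (f j * f i))
    (hsq : ∀ i ∈ G.isotropic, f i * f i = 0) :
    G.relatorIdeal.carrier ≤ LinearMap.ker (G.freeLieMap f) := by
  refine LieSuperalgebra.idealGenerated_le _ ?_ ?_ ?_
  · rintro _ (⟨i, j, hij, h, rfl⟩ | ⟨i, hi, rfl⟩)
    · rw [SetLike.mem_coe, LinearMap.mem_ker,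
        G.freeLieMap_bracket f (G.freeLieGen_mem i) (G.freeLieGen_mem j), freeLieMap_gen,
        freeLieMap_gen, hcomm i j hij h, sub_self]
    · rw [SetLike.mem_coe, LinearMap.mem_ker,
        G.freeLieMap_bracket f (G.freeLieGen_mem i) (G.freeLieGen_mem i), freeLieMap_gen,
        hsq i hi, smul_zero, sub_zero]
  · rintro _ (⟨i, j, hij, h, rfl⟩ | ⟨i, hi, rfl⟩)
    · exact ⟨_, (freeLie G.parity).bracket_mem (G.freeLieGen_mem i) (G.freeLieGen_mem j)⟩
    · exact ⟨_, (freeLie G.parity).bracket_mem (G.freeLieGen_mem i) (G.freeLieGen_mem i)⟩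
  · intro i j x y hx hy hyj
    rw [LinearMap.mem_ker] at hy ⊢
    rw [G.freeLieMap_bracket f hx hyj, hy, mul_zero, zero_mul, smul_zero, sub_zero]

/-- The algebra map out of the enveloping algebra given by elements `f i` that satisfy the defining
relations. -/
def lift (f : I → A)
    (hcomm : ∀ i j, i ≠ j → ¬ G.graph.Adj i j →
      f i * f j = superSign (G.parity i) (G.parity j) • (f j * f i))
    (hsq : ∀ i ∈ G.isotropic, f i * f i = 0) : G.U →ₐ[ℂ] A :=
  G.pcLie.liftEnveloping
    (G.relatorIdeal.carrier.liftQ (G.freeLieMap f) (G.relatorIdeal_le_ker_freeLieMap hcomm hsq)) (by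
      rintro i j _ _ ⟨x, hx, rfl⟩ ⟨y, hy, rfl⟩
      exact G.freeLieMap_bracket f hx hy)

theorem lift_e (f : I → A) (hcomm hsq) (i : I) : G.lift f hcomm hsq (G.e i) = f i :=
  (LieSuperalgebra.liftEnveloping_toEnveloping _ _ _ _).trans (G.freeLieMap_gen f i)

end Lift

theorem cls_comm {i j : I} (h : ¬ G.graph.Adj i j) :
    G.cls [i] * G.cls [j] = G.cls [j] * G.cls [i] :=
  (Con.eq _).mpr (Con.le_conGen _ _ (.swap h))

section Representation

variable [LinearOrder I]

/-! ### The representation on the Cartier-Foata monoid with signs -/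

/-- The sign of moving `i` past a smaller letter `j`. -/
def letterSign (i j : I) : ℂ := if j < i then superSign (G.parity i) (G.parity j) else 1

theorem superSign_comm (i j : ZMod 2) : superSign i j = superSign j i := by
  simp only [superSign, and_comm]

theorem superSign_mul_self (i j : ZMod 2) : superSign i j * superSign i j = 1 := by
  unfold superSign; split_ifs <;> simp

theorem letterSign_ne_zero (i j : I) : G.letterSign i j ≠ 0 := by
  unfold letterSign superSign; split_ifs <;> simp

/-- Of the two letters exactly one is the larger, so exactly one of the two orders carries the sign.
-/
theorem letterSign_eq {i j : I} (h : i ≠ j) :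
    G.letterSign i j = superSign (G.parity i) (G.parity j) * G.letterSign j i := by
  rcases lt_or_gt_of_ne h with hij | hij
  · rw [letterSign, letterSign, if_neg hij.not_gt, if_pos hij, superSign_comm (G.parity j),
      superSign_mul_self]
  · rw [letterSign, letterSign, if_pos hij, if_neg hij.not_gt, mul_one]

/-- The sign of moving `i` past all smaller letters. -/
def leftSign (i : I) : G.CartierFoata →* ℂ :=
  (conGen G.CommRel).lift (FreeMonoid.lift (G.letterSign i)) (by
    -- Products of letter signs are taken in the commutative monoid `ℂ`, so swapping letters does
    -- not affect them.
    rw [Con.conGen_le]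
    rintro _ _ ⟨h⟩
    simp [Con.ker_rel, mul_comm])

theorem leftSign_letter (i j : I) : G.leftSign i (G.cls [j]) = G.letterSign i j := rfl

theorem leftSign_ne_zero (i : I) (m : G.CartierFoata) : G.leftSign i m ≠ 0 := by
  obtain ⟨w, rfl⟩ := G.cls_surjective m
  induction w with
  | nil => exact (map_one (G.leftSign i)).trans_ne one_ne_zero
  | cons j w ih =>
    rw [← List.singleton_append, cls_append, map_mul, leftSign_letter]
    exact mul_ne_zero (G.letterSign_ne_zero i j) ih

open Classical in
/-- Signed left multiplication by the letter `i`, followed by the projection to the span of the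
modified monoid. -/
def leftOp (i : I) : Module.End ℂ (G.CartierFoata →₀ ℂ) :=
  Finsupp.linearCombination ℂ fun m =>
    if G.cls [i] * m ∈ G.modifiedMonoid then
      Finsupp.single (G.cls [i] * m) (G.leftSign i m) else 0

theorem leftOp_of_mem {i : I} {m : G.CartierFoata} (h : G.cls [i] * m ∈ G.modifiedMonoid) (c : ℂ) :
    G.leftOp i (Finsupp.single m c) = Finsupp.single (G.cls [i] * m) (c * G.leftSign i m) := by
  simp [leftOp, h]

theorem leftOp_of_notMem {i : I} {m : G.CartierFoata} (h : G.cls [i] * m ∉ G.modifiedMonoid)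
    (c : ℂ) : G.leftOp i (Finsupp.single m c) = 0 := by
  simp [leftOp, h]

theorem leftOp_leftOp_of_mem {i j : I} {m : G.CartierFoata}
    (h : G.cls [i] * (G.cls [j] * m) ∈ G.modifiedMonoid) (c : ℂ) :
    G.leftOp i (G.leftOp j (Finsupp.single m c)) =
      Finsupp.single (G.cls [i] * (G.cls [j] * m))
        (c * G.leftSign j m * (G.letterSign i j * G.leftSign i m)) := by
  rw [leftOp_of_mem G (G.mem_modifiedMonoid_of_mul h), leftOp_of_mem G h, map_mul, leftSign_letter]

/-- Either the inner operator or the outer one kills the vector. Vanishing of the composite thus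
depends only on the product class, which is the same for both orders of commuting letters. -/
theorem leftOp_leftOp_of_notMem {i j : I} {m : G.CartierFoata}
    (h : G.cls [i] * (G.cls [j] * m) ∉ G.modifiedMonoid) (c : ℂ) :
    G.leftOp i (G.leftOp j (Finsupp.single m c)) = 0 := by
  by_cases hj : G.cls [j] * m ∈ G.modifiedMonoid
  · rw [leftOp_of_mem G hj, leftOp_of_notMem G h]
  · rw [leftOp_of_notMem G hj, map_zero]

theorem leftOp_mul_comm {i j : I} (hij : i ≠ j) (h : ¬ G.graph.Adj i j) :
    G.leftOp i * G.leftOp j =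
      superSign (G.parity i) (G.parity j) • (G.leftOp j * G.leftOp i) := by
  refine Finsupp.lhom_ext fun m c => ?_
  have hc : G.cls [i] * (G.cls [j] * m) = G.cls [j] * (G.cls [i] * m) := by
    rw [← mul_assoc, G.cls_comm h, mul_assoc]
  simp only [LinearMap.smul_apply, Module.End.mul_apply]
  by_cases hm : G.cls [i] * (G.cls [j] * m) ∈ G.modifiedMonoid
  · rw [leftOp_leftOp_of_mem G hm, leftOp_leftOp_of_mem G (hc ▸ hm), hc, Finsupp.smul_single,
      G.letterSign_eq hij, smul_eq_mul]
    congr 1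
    ring
  · rw [leftOp_leftOp_of_notMem G hm, leftOp_leftOp_of_notMem G (hc ▸ hm), smul_zero]

theorem leftOp_mul_self {i : I} (hi : i ∈ G.isotropic) : G.leftOp i * G.leftOp i = 0 :=
  Finsupp.lhom_ext fun m c =>
    G.leftOp_leftOp_of_notMem (G.sq_mul_notMem_modifiedMonoid hi m) c

/-- The representation of the enveloping algebra given by the operators `leftOp`. -/
def rep : G.U →ₐ[ℂ] Module.End ℂ (G.CartierFoata →₀ ℂ) :=
  G.lift G.leftOp (fun _ _ => G.leftOp_mul_comm) (fun _ => G.leftOp_mul_self)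

theorem rep_e (i : I) : G.rep (G.e i) = G.leftOp i := G.lift_e _ _ _ i

/-- Right factors of elements of $\mathcal M'(\mathcal G)$ stay in $\mathcal M'(\mathcal G)$, so no
letter, applied from the right end of `w`, kills the vector. -/
theorem exists_rep_monomial {w : List I} (hw : G.cls w ∈ G.modifiedMonoid) :
    ∃ c : ℂ, c ≠ 0 ∧
      G.rep (G.monomial w) (Finsupp.single 1 1) = Finsupp.single (G.cls w) c := by
  induction w with
  | nil => exact ⟨1, one_ne_zero, by
    rw [show G.monomial [] = 1 from rfl, map_one]; rfl⟩
  | cons i w ih =>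
    have hw' : G.cls [i] * G.cls w ∈ G.modifiedMonoid := hw
    obtain ⟨c, hc, h⟩ := ih (G.mem_modifiedMonoid_of_mul hw')
    refine ⟨c * G.leftSign i (G.cls w), mul_ne_zero hc (G.leftSign_ne_zero i _), ?_⟩
    have hm : G.monomial (i :: w) = G.e i * G.monomial w := by simp [monomial]
    rw [hm, map_mul, Module.End.mul_apply, h, rep_e, leftOp_of_mem G hw']
    rfl

/-! ### The basis -/

theorem cls_wMax (m : G.CartierFoata) : G.cls (G.wMax m) = m := (G.wMax_isGreatest m).1

theorem linearIndependent_monomial_wMax :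
    LinearIndependent ℂ fun m : G.modifiedMonoid => G.monomial (G.wMax m) := by
  have key : ∀ m : G.modifiedMonoid, ∃ c : ℂ, c ≠ 0 ∧
      G.rep (G.monomial (G.wMax m)) (Finsupp.single 1 1) = Finsupp.single (m : G.CartierFoata) c := by
    intro m
    have h := G.exists_rep_monomial (w := G.wMax m) (by rw [cls_wMax]; exact m.2)
    rwa [cls_wMax] at h
  choose c hc h using key
  -- Evaluation of the representation at the basis vector of the empty word; independence of the
  -- images under `f` suffices.
  let f : G.U →ₗ[ℂ] (G.CartierFoata →₀ ℂ) :=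
    LinearMap.applyₗ (Finsupp.single (1 : G.CartierFoata) (1 : ℂ)) ∘ₗ G.rep.toLinearMap
  refine LinearIndependent.of_comp f ?_
  have hf : f ∘ (fun m : G.modifiedMonoid => G.monomial (G.wMax m)) =
      fun m : G.modifiedMonoid => Units.mk0 (c m) (hc m) •
        Finsupp.single (m : G.CartierFoata) (1 : ℂ) := by
    funext m
    refine (h m).trans ?_
    simp [Units.smul_def]
  rw [hf]
  exact ((Finsupp.linearIndependent_single_one ℂ G.CartierFoata).comp _
    Subtype.val_injective).units_smul fun m => Units.mk0 (c m) (hc m)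

theorem span_monomial_wMax :
    Submodule.span ℂ (Set.range fun m : G.modifiedMonoid => G.monomial (G.wMax m)) = ⊤ := by
  rw [eq_top_iff, ← G.span_range_monomial, Submodule.span_le]
  rintro _ ⟨w, rfl⟩
  by_cases hw : G.cls w ∈ G.modifiedMonoid
  · obtain ⟨c, hc⟩ := G.exists_monomial_eq_smul (G.cls_wMax (G.cls w)).symm
    rw [SetLike.mem_coe, hc]
    exact Submodule.smul_mem _ (c : ℂ) (Submodule.subset_span ⟨⟨_, hw⟩, rfl⟩)
  · rw [SetLike.mem_coe, G.monomial_eq_zero hw]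
    exact zero_mem _

end Representation

end MarkedGraph

end

theorem mainTheorem8 {I : Type*} [Countable I] [LinearOrder I] (G : MarkedGraph I) :
    ∃ b : Module.Basis G.modifiedMonoid ℂ G.U,
      ∀ m : G.modifiedMonoid, b m = G.monomial (G.wMax m) :=
  ⟨.mk G.linearIndependent_monomial_wMax G.span_monomial_wMax.ge,
    fun _ => Module.Basis.mk_apply _ _ _⟩
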